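/- Let $\mathbb K=\mathbb R$ or $\mathbb C$, let $n\ge 1$, let $E_1,\dots,E_n,F$ be Banach spaces over $\mathbb K$ with topological duals $E_i'$, $F'$ and closed unit balls $B_{E_i}$, $B_{F'}$, let $1\le p<\infty$ and let $p'\in(1,\infty]$ be given by $\frac1p+\frac1{p'}=1$. A continuous $n$-linear operator $A\colon E_1\times\cdots\times E_n\to F$ is of finite type if, for some $m\in\mathbb N$, it has a finite representation $$A(x_1,\dots,x_n)=\sum_{j=1}^m\lambda_j\,x'_{1j}(x_1)\cdots x'_{nj}(x_n)\,y_j\qquad(x_i\in E_i)\qquad(1)$$ with $\lambda_j\in\mathbb K$, $x'_{ij}\in E_i'$, $y_j\in F$; the space of these operators is $\mathcal L_f(E_1,\dots,E_n;F)$. For $A\in\mathcal L_f(E_1,\dots,E_n;F)$ put $$\|A\|_{\sigma(p)f}=\inf\Bigl\{\|(\lambda_j)_{j=1}^m\|_{p'}\cdot\sup_{x_i\in B_{E_i},\,y'\in B_{F'}}\Bigl(\sum_{j=1}^m|x'_{1j}(x_1)\cdots x'_{nj}(x_n)\,y'(y_j)|^p\Bigr)^{1/p}\Bigr\},$$ the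 infimum being over all finite representations (1) of $A$. A $\sigma(p)$-nuclear representation of a continuous $n$-linear operator $A$ consists of $(\lambda_j)_{j=1}^\infty\in\ell_{p'}$ and sequences $(x'_{ij})_{j=1}^\infty$ in $E_i'$ $(i=1,\dots,n)$ and $(y_j)_{j=1}^\infty$ in $F$ such that $A(x_1,\dots,x_n)=\sum_{j=1}^\infty\lambda_j\,x'_{1j}(x_1)\cdots x'_{nj}(x_n)\,y_j$ for all $x_i\in E_i$, $$\sup_{x_i\in B_{E_i},\,y'\in B_{F'}}\Bigl(\sum_{j=1}^\infty|x'_{1j}(x_1)\cdots x'_{nj}(x_n)\,y'(y_j)|^p\Bigr)^{1/p}<\infty,$$ $$\lim_{m\to\infty}\ \sup_{x_i\in B_{E_i},\,y'\in B_{F'}}\Bigl(\sum_{j=m}^\infty|x'_{1j}(x_1)\cdots x'_{nj}(x_n)\,y'(y_j)|^p\Bigr)^{1/p}=0.$$ The operator $A$ is $\sigma(p)$-nuclear if it has such a representation, and then $$\|A\|_{\sigma(p)}=\inf\Bigl\{\|(\lambda_j)_{j=1}^\infty\|_{p'}\cdot\sup_{x_i\in B_{E_i},\,y'\in B_{F'}}\Bigl(\sum_{j=1}^\infty|x'_{1j}(x_1)\cdots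 x'_{nj}(x_n)\,y'(y_j)|^p\Bigr)^{1/p}\Bigr\},$$ the infimum being over all $\sigma(p)$-nuclear representations of $A$. A Banach space $X$ has the bounded approximation property if there is $\gamma\ge1$ such that for every compact $K\subseteq X$ and every $\varepsilon>0$ there is a finite-rank bounded linear operator $T\colon X\to X$ with $\|T\|\le\gamma$ and $\|Tx-x\|\le\varepsilon$ for all $x\in K$. **Proposition.** If $E_1',\dots,E_n'$ have the bounded approximation property, then, for every Banach space $F$, every $A\in\mathcal L_f(E_1,\dots,E_n;F)$ is $\sigma(p)$-nuclear and $$\|A\|_{\sigma(p)f}=\|A\|_{\sigma(p)}.$$ -/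

import Mathlib

open scoped ENNReal Topology
open Filter

namespace SigmaNuclear

/-- A normed space `X` has the bounded approximation property: for some `γ ≥ 1`, the identity of `X`
can be approximated, uniformly on every compact set, by finite-rank bounded operators of norm at
most `γ`. -/
def HasBAP (𝕜 X : Type*) [RCLike 𝕜] [NormedAddCommGroup X] [NormedSpace 𝕜 X] : Prop :=
  ∃ γ : ℝ, 1 ≤ γ ∧ ∀ K : Set X, IsCompact K → ∀ ε : ℝ, 0 < ε →
    ∃ T : X →L[𝕜] X, FiniteDimensional 𝕜 (LinearMap.range (T : X →ₗ[𝕜] X)) ∧ ‖T‖ ≤ γ ∧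
      ∀ x ∈ K, ‖T x - x‖ ≤ ε

section

variable {𝕜 : Type*} [RCLike 𝕜] {n : ℕ} {E : Fin n → Type*}
  [∀ i, NormedAddCommGroup (E i)] [∀ i, NormedSpace 𝕜 (E i)]
  {F : Type*} [NormedAddCommGroup F] [NormedSpace 𝕜 F]

/-- The exponent `p'` conjugate to `p ∈ [1, ∞)`; it is `∞` for `p = 1`. -/
noncomputable def conjExp (p : ℝ) : ℝ≥0∞ := ENNReal.conjExponent (ENNReal.ofReal p)

/-- The quantity `sup (∑ⱼ |x'₁ⱼ(u₁) ⋯ x'ₙⱼ(uₙ) φ(yⱼ)|^p)^(1/p)`, the supremum being over all `uᵢ` in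
the closed unit ball of `Eᵢ` and all `φ` in the closed unit ball of `F'`. The functional `x'ᵢⱼ` is
written `x j i`; the value may be `∞`. -/
noncomputable def weakSup {ι : Type*} (p : ℝ) (x : ι → ∀ i, StrongDual 𝕜 (E i)) (y : ι → F) :
    ℝ≥0∞ :=
  ⨆ (u : ∀ i, Metric.closedBall (0 : E i) 1) (φ : Metric.closedBall (0 : StrongDual 𝕜 F) 1),
    (∑' j : ι, ‖(∏ i, x j i (u i : E i)) * (φ : StrongDual 𝕜 F) (y j)‖ₑ ^ p) ^ (1 / p)

/-- `A = ∑_{j < m} λⱼ x'₁ⱼ ⊗ ⋯ ⊗ x'ₙⱼ ⊗ yⱼ`. -/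
def IsFiniteRep (A : ContinuousMultilinearMap 𝕜 E F) {m : ℕ} (lam : Fin m → 𝕜)
    (x : Fin m → ∀ i, StrongDual 𝕜 (E i)) (y : Fin m → F) : Prop :=
  ∀ u : ∀ i, E i, A u = ∑ j, (lam j * ∏ i, x j i (u i)) • y j

/-- `A` is of finite type. -/
def IsFiniteType (A : ContinuousMultilinearMap 𝕜 E F) : Prop :=
  ∃ (m : ℕ) (lam : Fin m → 𝕜) (x : Fin m → ∀ i, StrongDual 𝕜 (E i)) (y : Fin m → F),
    IsFiniteRep A lam x y

/-- `A = ∑_{j} λⱼ x'₁ⱼ ⊗ ⋯ ⊗ x'ₙⱼ ⊗ yⱼ` (a pointwise convergent series) is a `σ(p)`-nuclear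
representation of `A`. -/
structure IsNuclearRep (p : ℝ) (A : ContinuousMultilinearMap 𝕜 E F)
    (lam : lp (fun _ : ℕ => 𝕜) (conjExp p)) (x : ℕ → ∀ i, StrongDual 𝕜 (E i)) (y : ℕ → F) :
    Prop where
  tendsto_sum : ∀ u : ∀ i, E i,
    Tendsto (fun m : ℕ => ∑ j ∈ Finset.range m, (lam j * ∏ i, x j i (u i)) • y j) atTop (𝓝 (A u))
  weakSup_lt_top : weakSup p x y < ∞
  tendsto_tail :
    Tendsto (fun m : ℕ => weakSup p (fun j => x (m + j)) (fun j => y (m + j))) atTop (𝓝 0)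

/-- `A` is `σ(p)`-nuclear. -/
def IsSigmaNuclear (p : ℝ) (A : ContinuousMultilinearMap 𝕜 E F) : Prop :=
  ∃ (lam : lp (fun _ : ℕ => 𝕜) (conjExp p)) (x : ℕ → ∀ i, StrongDual 𝕜 (E i)) (y : ℕ → F),
    IsNuclearRep p A lam x y

/-- The `σ(p)`-nuclear norm: the infimum of `‖λ‖_{p'} * weakSup` over all `σ(p)`-nuclear
representations (meaningful when `A` is `σ(p)`-nuclear). -/
noncomputable def nuclearNorm (p : ℝ) (A : ContinuousMultilinearMap 𝕜 E F) : ℝ :=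
  sInf {c : ℝ | ∃ (lam : lp (fun _ : ℕ => 𝕜) (conjExp p)) (x : ℕ → ∀ i, StrongDual 𝕜 (E i))
    (y : ℕ → F), IsNuclearRep p A lam x y ∧ c = ‖lam‖ * (weakSup p x y).toReal}

/-- The finite `σ(p)`-nuclear norm: the infimum of `‖λ‖_{p'} * weakSup` over all finite
representations (meaningful when `A` is of finite type). -/
noncomputable def finiteNuclearNorm (p : ℝ) (A : ContinuousMultilinearMap 𝕜 E F) : ℝ :=
  sInf {c : ℝ | ∃ (m : ℕ) (lam : Fin m → 𝕜) (x : Fin m → ∀ i, StrongDual 𝕜 (E i)) (y : Fin m → F),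
    IsFiniteRep A lam x y ∧ c = ‖WithLp.toLp (conjExp p) lam‖ * (weakSup p x y).toReal}

end

end SigmaNuclear

namespace SigmaNuclear

/-! Extending finite representations by zero gives nuclearity and `nuclearNorm ≤ finiteNuclearNorm`.
The other inequality needs, for a nuclear representation of A with coefficients λ and weak norm W,
finite representations with bounds arbitrarily close to ‖λ‖ and W; this is
`IsNuclearRep.hasRepBound`.

Let S_m be the partial sums and R_m = A - S_m. As A is of finite type, so is R_m, but a finite
expression for it gives no control of its cost. Let finite-rank T_i approximate the identity on the
finitely many functionals of that expression, and write T·B for B with T_i applied to its i-th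
functionals. Then for M ≥ m A = S_m + T·(S_M - S_m) + T·R_M + (R_m - T·R_m). The first term costs at
most ‖λ‖ and W. The second has weak norm at most ∏‖T_i‖ times that of the tail from m
(`weakSup_map_le`). The last has a small representation because the functionals move little
(`exists_pos_hasRepBound_sub`). For the third, R_M tends to 0 in operator norm, and T·R_M has
functionals in fixed finite-dimensional spaces, so a small operator norm yields a small
representation (`exists_pos_hasRepBound_of_finiteRank`).

The order of choice is m, then T, then M. The tail bound at m must absorb ∏‖T_i‖ before T is known,
which is why the approximation property has to be bounded. -/

theorem one_le_conjExp (p : ℝ) : 1 ≤ conjExp p := by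
  simp [conjExp, ENNReal.conjExponent]

theorem holderConjugate_conjExp {p : ℝ} (hp : 1 < p) :
    p.HolderConjugate (conjExp p).toReal := by
  have h := ENNReal.HolderConjugate.conjExponent (p := ENNReal.ofReal p)
    (by simpa using hp.le)
  have h0 : (ENNReal.ofReal p).toReal = p := ENNReal.toReal_ofReal (by linarith)
  have := (ENNReal.HolderConjugate.toReal_iff (by rwa [h0])).2 h
  rwa [h0] at this

theorem toReal_ofReal_pos {p : ℝ} (hp : 1 ≤ p) : 0 < (ENNReal.ofReal p).toReal := by
  rw [ENNReal.toReal_ofReal (by linarith)]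
  linarith

/-! ### Coefficient norms in ℓ_q and Hölder's inequality -/

section PiLp

variable {𝕜 : Type*} [RCLike 𝕜] {ι κ : Type*} [Fintype ι] [Fintype κ]

/-- The coefficients `Sum.elim a b` have norm at most the sum of the norms. -/
theorem norm_toLp_sumElim_le {q : ℝ≥0∞} (hq : 1 ≤ q) (a : ι → 𝕜) (b : κ → 𝕜) :
    ‖WithLp.toLp q (Sum.elim a b)‖ ≤ ‖WithLp.toLp q a‖ + ‖WithLp.toLp q b‖ := by
  have : Fact (1 ≤ q) := ⟨hq⟩
  rcases eq_or_ne q ∞ with rfl | hq'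
  · rw [PiLp.norm_eq_ciSup]
    refine Real.iSup_le (fun j => ?_) (by positivity)
    rcases j with j | j
    · exact (PiLp.norm_apply_le (WithLp.toLp ∞ a) j).trans (by simp)
    · exact (PiLp.norm_apply_le (WithLp.toLp ∞ b) j).trans (by simp)
  · have hpos : 0 < q.toReal := ENNReal.toReal_pos (by positivity) hq'
    have h1 : 1 ≤ q.toReal := by
      rw [← ENNReal.ofReal_le_iff_le_toReal hq']; simpa using hq
    simp only [PiLp.norm_eq_sum hpos, Fintype.sum_sum_type, Sum.elim_inl, Sum.elim_inr]
    exact Real.rpow_add_le_add_rpow (by positivity) (by positivity) (by positivity)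
      (by rw [div_le_one hpos]; exact h1)

theorem norm_toLp_comp_equiv {q : ℝ≥0∞} (hq : 1 ≤ q) (e : ι ≃ κ) (a : κ → 𝕜) :
    ‖WithLp.toLp q (a ∘ e)‖ = ‖WithLp.toLp q a‖ := by
  have : Fact (1 ≤ q) := ⟨hq⟩
  rcases eq_or_ne q ∞ with rfl | hq'
  · rw [PiLp.norm_eq_ciSup, PiLp.norm_eq_ciSup]
    exact e.iSup_comp (g := fun j => ‖a j‖)
  · have hpos : 0 < q.toReal := ENNReal.toReal_pos (by positivity) hq'
    simp only [PiLp.norm_eq_sum hpos]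
    congr 1
    exact e.sum_comp (fun j => ‖a j‖ ^ q.toReal)

/-- Restricting a sequence of `ℓ_q` to finitely many places does not increase the norm. -/
theorem norm_toLp_comp_le {q : ℝ≥0∞} (hq : 1 ≤ q) {α : Type*} (a : lp (fun _ : α => 𝕜) q)
    {e : ι → α} (he : Function.Injective e) :
    ‖WithLp.toLp q (fun j => a (e j))‖ ≤ ‖a‖ := by
  have : Fact (1 ≤ q) := ⟨hq⟩
  rcases eq_or_ne q ∞ with rfl | hq'
  · rw [PiLp.norm_eq_ciSup]
    exact Real.iSup_le (fun j => lp.norm_apply_le_norm (by simp) a _) (norm_nonneg _)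
  · have hpos : 0 < q.toReal := ENNReal.toReal_pos (by positivity) hq'
    rw [PiLp.norm_eq_sum hpos]
    have := lp.sum_rpow_le_norm_rpow hpos a (Finset.univ.map ⟨e, he⟩)
    rw [Finset.sum_map] at this
    refine (Real.rpow_le_rpow (by positivity) this (by positivity)).trans ?_
    rw [← Real.rpow_mul (norm_nonneg _), mul_one_div_cancel hpos.ne', Real.rpow_one]

/-- Extension by zero embeds the finite-dimensional `ℓ_q` into the sequence space `ℓ_q`. -/
theorem exists_lp_extend {q : ℝ≥0∞} (hq : 1 ≤ q) {m : ℕ} (a : Fin m → 𝕜) :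
    ∃ b : lp (fun _ : ℕ => 𝕜) q, (∀ j, b j = if h : j < m then a ⟨j, h⟩ else 0) ∧
      ‖b‖ ≤ ‖WithLp.toLp q a‖ := by
  have : Fact (1 ≤ q) := ⟨hq⟩
  set f : ℕ → 𝕜 := fun j => if h : j < m then a ⟨j, h⟩ else 0 with hf
  have hmem : Memℓp f q := by
    -- Exponent 0 encodes finite support, which implies membership for every q.
    refine Memℓp.of_exponent_ge (E := fun _ : ℕ => 𝕜) (q := 0) (memℓp_zero ?_) bot_le
    refine (Set.finite_lt_nat m).subset fun j hj => ?_
    by_contra h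
    exact hj (by simp only [hf]; exact dif_neg h)
  refine ⟨⟨f, hmem⟩, fun j => rfl, ?_⟩
  rcases eq_or_ne q ∞ with rfl | hq'
  · refine lp.norm_le_of_forall_le (norm_nonneg _) fun j => ?_
    change ‖f j‖ ≤ _
    by_cases h : j < m
    · simp only [hf, h, dite_true]
      exact PiLp.norm_apply_le (WithLp.toLp ∞ a) _
    · simp [hf, h]
  · have hpos : 0 < q.toReal := ENNReal.toReal_pos (by positivity) hq'
    refine lp.norm_le_of_forall_sum_le hpos (norm_nonneg _) fun s => ?_
    rw [PiLp.norm_eq_sum hpos, ← Real.rpow_mul (by positivity), one_div_mul_cancel hpos.ne',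
      Real.rpow_one]
    have hz : ∀ j, ¬ j < m → ‖f j‖ ^ q.toReal = 0 := fun j h => by
      simp [hf, h, hpos.ne']
    calc ∑ j ∈ s, ‖f j‖ ^ q.toReal ≤ ∑ j ∈ s ∪ Finset.range m, ‖f j‖ ^ q.toReal :=
          Finset.sum_le_sum_of_subset_of_nonneg Finset.subset_union_left
            fun _ _ _ => by positivity
      _ = ∑ j ∈ Finset.range m, ‖f j‖ ^ q.toReal := by
          refine (Finset.sum_subset Finset.subset_union_right fun j _ h => hz j ?_).symm
          simpa using h
      _ = ∑ j : Fin m, ‖a j‖ ^ q.toReal := by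
          rw [Finset.sum_range]
          simp [hf]

/-- Hölder's inequality. -/
theorem norm_sum_mul_le {p : ℝ} (hp : 1 ≤ p) (a b : ι → 𝕜) :
    ‖∑ j, a j * b j‖ ≤
      ‖WithLp.toLp (conjExp p) a‖ * ‖WithLp.toLp (ENNReal.ofReal p) b‖ := by
  have : Fact (1 ≤ conjExp p) := ⟨one_le_conjExp p⟩
  refine (norm_sum_le _ _).trans ?_
  simp only [norm_mul]
  rw [PiLp.norm_eq_sum (p := ENNReal.ofReal p) (toReal_ofReal_pos hp),
    ENNReal.toReal_ofReal (by linarith)]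
  rcases hp.eq_or_lt with rfl | hp
  · simp only [Real.rpow_one, div_one, Finset.mul_sum]
    gcongr with j
    exact PiLp.norm_apply_le (WithLp.toLp (conjExp 1) a) j
  · have h := holderConjugate_conjExp hp
    rw [PiLp.norm_eq_sum h.symm.pos]
    simpa using Real.inner_le_Lp_mul_Lq_of_nonneg (s := Finset.univ) (f := fun j => ‖a j‖)
      (g := fun j => ‖b j‖) h.symm (by simp) (by simp)

theorem enorm_toLp_eq {p : ℝ} (hp : 1 ≤ p) (a : ι → 𝕜) :
    ENNReal.ofReal ‖WithLp.toLp (ENNReal.ofReal p) a‖ = (∑ j, ‖a j‖ₑ ^ p) ^ (1 / p) := by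
  rw [PiLp.norm_eq_sum (p := ENNReal.ofReal p) (toReal_ofReal_pos hp),
    ENNReal.toReal_ofReal (by linarith), ← ENNReal.ofReal_rpow_of_nonneg (by positivity)
    (by positivity), ENNReal.ofReal_sum_of_nonneg (fun _ _ => by positivity)]
  simp_rw [← ENNReal.ofReal_rpow_of_nonneg (norm_nonneg _) (show 0 ≤ p by linarith),
    ofReal_norm]

end PiLp
-- Weak norms and the action of operators on the functionals
section

variable {𝕜 : Type*} [RCLike 𝕜] {n : ℕ} {E : Fin n → Type*}
  [∀ i, NormedAddCommGroup (E i)] [∀ i, NormedSpace 𝕜 (E i)]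
  {F : Type*} [NormedAddCommGroup F] [NormedSpace 𝕜 F]

theorem exists_smul_eq_of_norm {G : Type*} [NormedAddCommGroup G] [NormedSpace 𝕜 G] (u : G) :
    ∃ v : G, ‖v‖ ≤ 1 ∧ u = ((‖u‖ : ℝ) : 𝕜) • v := by
  rcases eq_or_ne u 0 with rfl | hu
  · exact ⟨0, by simp, by simp⟩
  · have h : ((‖u‖ : ℝ) : 𝕜) ≠ 0 := by simpa using hu
    refine ⟨((‖u‖ : ℝ) : 𝕜)⁻¹ • u, ?_, by rw [smul_inv_smul₀ h]⟩
    rw [norm_smul, norm_inv, RCLike.norm_ofReal, abs_norm, inv_mul_cancel₀ (by simpa using hu)]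

theorem tsum_le_weakSup {ι : Type*} {p : ℝ} (x : ι → ∀ i, StrongDual 𝕜 (E i)) (y : ι → F)
    {u : ∀ i, E i} (hu : ∀ i, ‖u i‖ ≤ 1) {φ : StrongDual 𝕜 F} (hφ : ‖φ‖ ≤ 1) :
    (∑' j, ‖(∏ i, x j i (u i)) * φ (y j)‖ₑ ^ p) ^ (1 / p) ≤ weakSup p x y := by
  let u' : ∀ i, Metric.closedBall (0 : E i) 1 := fun i => ⟨u i, mem_closedBall_zero_iff.2 (hu i)⟩
  let φ' : Metric.closedBall (0 : StrongDual 𝕜 F) 1 := ⟨φ, mem_closedBall_zero_iff.2 hφ⟩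
  exact le_iSup₂ (f := fun (u : ∀ i, Metric.closedBall (0 : E i) 1)
    (φ : Metric.closedBall (0 : StrongDual 𝕜 F) 1) =>
    (∑' j, ‖(∏ i, x j i (u i : E i)) * (φ : StrongDual 𝕜 F) (y j)‖ₑ ^ p) ^ (1 / p)) u' φ'

section Finite

variable {ι : Type*} [Fintype ι] {p : ℝ} {x : ι → ∀ i, StrongDual 𝕜 (E i)} {y : ι → F}

theorem weakSup_le_ofReal (hp : 1 ≤ p) {C : ℝ}
    (h : ∀ u : ∀ i, E i, (∀ i, ‖u i‖ ≤ 1) → ∀ φ : StrongDual 𝕜 F, ‖φ‖ ≤ 1 →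
      ‖WithLp.toLp (ENNReal.ofReal p) (fun j => (∏ i, x j i (u i)) * φ (y j))‖ ≤ C) :
    weakSup p x y ≤ ENNReal.ofReal C := by
  refine iSup₂_le fun u φ => ?_
  rw [tsum_fintype, ← enorm_toLp_eq hp]
  exact ENNReal.ofReal_le_ofReal (h _ (fun i => mem_closedBall_zero_iff.1 (u i).2) _
    (mem_closedBall_zero_iff.1 φ.2))

theorem norm_toLp_le_of_weakSup_le (hp : 1 ≤ p) {C : ℝ} (hC : 0 ≤ C)
    (h : weakSup p x y ≤ ENNReal.ofReal C) (u : ∀ i, E i) {φ : StrongDual 𝕜 F} (hφ : ‖φ‖ ≤ 1) :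
    ‖WithLp.toLp (ENNReal.ofReal p) (fun j => (∏ i, x j i (u i)) * φ (y j))‖ ≤
      C * ∏ i, ‖u i‖ := by
  have : Fact (1 ≤ ENNReal.ofReal p) := ⟨by simpa using hp⟩
  choose v hv huv using fun i => exists_smul_eq_of_norm (𝕜 := 𝕜) (u i)
  have key : ‖WithLp.toLp (ENNReal.ofReal p) (fun j => (∏ i, x j i (v i)) * φ (y j))‖ ≤ C := by
    have h1 := (tsum_le_weakSup (p := p) x y hv hφ).trans h
    rw [tsum_fintype, ← enorm_toLp_eq hp] at h1
    exact (ENNReal.ofReal_le_ofReal_iff hC).1 h1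
  have e : (fun j => (∏ i, x j i (u i)) * φ (y j)) =
      (∏ i, ((‖u i‖ : ℝ) : 𝕜)) • fun j => (∏ i, x j i (v i)) * φ (y j) := by
    ext j
    have : ∀ i, x j i (u i) = ((‖u i‖ : ℝ) : 𝕜) * x j i (v i) := fun i => by
      conv_lhs => rw [huv i]
      simp
    simp only [this, Finset.prod_mul_distrib, Pi.smul_apply, smul_eq_mul, mul_assoc]
  rw [e, WithLp.toLp_smul, norm_smul, norm_prod, mul_comm]
  simp only [RCLike.norm_ofReal, abs_norm]
  gcongr

theorem weakSup_le_sum (hp : 1 ≤ p) (x : ι → ∀ i, StrongDual 𝕜 (E i)) (y : ι → F) :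
    weakSup p x y ≤ ENNReal.ofReal (∑ j, (∏ i, ‖x j i‖) * ‖y j‖) := by
  classical
  have : Fact (1 ≤ ENNReal.ofReal p) := ⟨by simpa using hp⟩
  refine weakSup_le_ofReal hp fun u hu φ hφ => ?_
  have e : WithLp.toLp (ENNReal.ofReal p) (fun j => (∏ i, x j i (u i)) * φ (y j)) =
      ∑ j, PiLp.single (ENNReal.ofReal p) j ((∏ i, x j i (u i)) * φ (y j)) := by
    ext k
    simp [Pi.single_apply]
  rw [e]
  refine (norm_sum_le _ _).trans (Finset.sum_le_sum fun j _ => ?_)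
  rw [PiLp.norm_single, norm_mul, norm_prod]
  gcongr with i
  · exact ((x j i).le_opNorm _).trans (mul_le_of_le_one_right (norm_nonneg _) (hu i))
  · exact (φ.le_opNorm _).trans (mul_le_of_le_one_left (norm_nonneg _) hφ)

theorem weakSup_lt_top (hp : 1 ≤ p) (x : ι → ∀ i, StrongDual 𝕜 (E i)) (y : ι → F) :
    weakSup p x y < ∞ :=
  (weakSup_le_sum hp x y).trans_lt ENNReal.ofReal_lt_top

/-- The operator represented by a family is bounded by the product of the two norms. -/
theorem norm_sum_smul_le (hp : 1 ≤ p) (lam : ι → 𝕜) {C : ℝ} (hC : 0 ≤ C)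
    (h : weakSup p x y ≤ ENNReal.ofReal C) (u : ∀ i, E i) :
    ‖∑ j, (lam j * ∏ i, x j i (u i)) • y j‖ ≤
      ‖WithLp.toLp (conjExp p) lam‖ * C * ∏ i, ‖u i‖ := by
  have : Fact (1 ≤ conjExp p) := ⟨one_le_conjExp p⟩
  obtain ⟨φ, hφ, hφ'⟩ := exists_dual_vector'' 𝕜 (∑ j, (lam j * ∏ i, x j i (u i)) • y j)
  have h1 : ‖φ (∑ j, (lam j * ∏ i, x j i (u i)) • y j)‖ ≤ ‖WithLp.toLp (conjExp p) lam‖ *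
      ‖WithLp.toLp (ENNReal.ofReal p) (fun j => (∏ i, x j i (u i)) * φ (y j))‖ := by
    simp only [map_sum, map_smul, smul_eq_mul, mul_assoc]
    exact norm_sum_mul_le hp lam fun j => (∏ i, x j i (u i)) * φ (y j)
  rw [hφ', RCLike.norm_ofReal, abs_norm] at h1
  refine h1.trans ?_
  rw [mul_assoc]
  gcongr
  exact norm_toLp_le_of_weakSup_le hp hC h u hφ

end Finite

theorem weakSup_comp_le {ι κ : Type*} {p : ℝ} (hp : 1 ≤ p) (x : κ → ∀ i, StrongDual 𝕜 (E i))
    (y : κ → F) {e : ι → κ} (he : Function.Injective e) :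
    weakSup p (fun j => x (e j)) (fun j => y (e j)) ≤ weakSup p x y := by
  refine iSup₂_mono fun u φ => ENNReal.rpow_le_rpow ?_ (by positivity)
  exact ENNReal.tsum_comp_le_tsum_of_injective he
    (fun j => ‖(∏ i, x j i (u i : E i)) * (φ : StrongDual 𝕜 F) (y j)‖ₑ ^ p)

/-- Subadditivity of s ↦ s^(1/p), valid as 1/p ≤ 1. The bound is crude but suffices, since only
small pieces are ever adjoined. -/
theorem weakSup_sumElim_le {ι κ : Type*} {p : ℝ} (hp : 1 ≤ p)
    (x : ι → ∀ i, StrongDual 𝕜 (E i)) (y : ι → F) (x' : κ → ∀ i, StrongDual 𝕜 (E i)) (y' : κ → F) :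
    weakSup p (Sum.elim x x') (Sum.elim y y') ≤ weakSup p x y + weakSup p x' y' := by
  refine iSup₂_le fun u φ => ?_
  rw [ENNReal.summable.tsum_sum ENNReal.summable]
  refine (ENNReal.rpow_add_le_add_rpow _ _ (by positivity) ?_).trans (add_le_add ?_ ?_)
  · rw [div_le_one (by linarith)]; exact hp
  · exact le_iSup₂_of_le u φ le_rfl
  · exact le_iSup₂_of_le u φ le_rfl

theorem weakSup_smul_le {ι : Type*} {p : ℝ} (hp : 1 ≤ p)
    (x : ι → ∀ i, StrongDual 𝕜 (E i)) (y : ι → F) (c : 𝕜) :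
    weakSup p x (fun j => c • y j) ≤ ‖c‖ₑ * weakSup p x y := by
  refine iSup₂_le fun u φ => ?_
  refine le_trans (le_of_eq ?_) (mul_le_mul_right (le_iSup₂_of_le u φ le_rfl) _)
  have hp0 : 0 < p := by linarith
  simp only [map_smul, smul_eq_mul, mul_left_comm _ c]
  simp only [enorm_mul c, ENNReal.mul_rpow_of_nonneg _ _ hp0.le, ENNReal.tsum_mul_left]
  rw [ENNReal.mul_rpow_of_nonneg _ _ (by positivity), ← ENNReal.rpow_mul,
    mul_one_div_cancel hp0.ne', ENNReal.rpow_one]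

/-- Bounds of a finite sum of elementary `n`-linear operators persist, up to the product of the
norms, when bounded operators act on the functionals. -/
theorem norm_sum_smul_map_le {ι Z : Type*} [Fintype ι] [NormedAddCommGroup Z] [NormedSpace 𝕜 Z]
    (x : ι → ∀ i, StrongDual 𝕜 (E i)) (z : ι → Z) {C : ℝ} (hC : 0 ≤ C)
    (h : ∀ u : ∀ i, E i, ‖∑ j, (∏ i, x j i (u i)) • z j‖ ≤ C * ∏ i, ‖u i‖)
    (T : ∀ i, StrongDual 𝕜 (E i) →L[𝕜] StrongDual 𝕜 (E i)) (u : ∀ i, E i) :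
    ‖∑ j, (∏ i, T i (x j i) (u i)) • z j‖ ≤ (∏ i, ‖T i‖) * C * ∏ i, ‖u i‖ := by
  classical
  -- The operators act one coordinate at a time. With the other variables fixed and a norming
  -- functional ψ applied, the sum is the value at `u a` of one element of the dual of `E a`; its
  -- norm is at most `D` by induction, and `T a` multiplies that by at most ‖T a‖.
  suffices H : ∀ (s : Finset (Fin n)) (u : ∀ i, E i),
      ‖∑ j, (∏ i, (if i ∈ s then T i (x j i) else x j i) (u i)) • z j‖ ≤
        (∏ i ∈ s, ‖T i‖) * C * ∏ i, ‖u i‖ by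
    simpa using H Finset.univ u
  intro s
  induction s using Finset.induction with
  | empty => simpa using h
  | insert a s ha ih =>
    intro u
    obtain ⟨ψ, hψ, hψ'⟩ := exists_dual_vector'' 𝕜
      (∑ j, (∏ i, (if i ∈ insert a s then T i (x j i) else x j i) (u i)) • z j)
    set c : ι → 𝕜 := fun j =>
      (∏ i ∈ Finset.univ.erase a, (if i ∈ s then T i (x j i) else x j i) (u i)) * ψ (z j) with hc
    set D : ℝ := (∏ i ∈ s, ‖T i‖) * C * ∏ i ∈ Finset.univ.erase a, ‖u i‖ with hD
    have hD0 : 0 ≤ D := by positivity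
    have h1 : ‖∑ j, c j • x j a‖ ≤ D := by
      refine ContinuousLinearMap.opNorm_le_bound _ hD0 fun v => ?_
      have e : (∑ j, c j • x j a) v =
          ψ (∑ j, (∏ i, (if i ∈ s then T i (x j i) else x j i) (Function.update u a v i)) •
            z j) := by
        simp only [map_sum, map_smul, smul_eq_mul, sum_apply,
          smul_apply]
        refine Finset.sum_congr rfl fun j _ => ?_
        rw [← Finset.mul_prod_erase _ _ (Finset.mem_univ a), if_neg ha, Function.update_self, hc]
        have : ∏ i ∈ Finset.univ.erase a, (if i ∈ s then T i (x j i) else x j i)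
            (Function.update u a v i) =
            ∏ i ∈ Finset.univ.erase a, (if i ∈ s then T i (x j i) else x j i) (u i) :=
          Finset.prod_congr rfl fun i hi => by
            rw [Function.update_of_ne (Finset.ne_of_mem_erase hi)]
        rw [this]
        ring
      rw [e]
      refine (ψ.le_opNorm _).trans ((mul_le_of_le_one_left (norm_nonneg _) hψ).trans
        ((ih _).trans (le_of_eq ?_)))
      rw [← Finset.mul_prod_erase _ _ (Finset.mem_univ a), Function.update_self, hD]
      have : ∏ i ∈ Finset.univ.erase a, ‖Function.update u a v i‖ =
          ∏ i ∈ Finset.univ.erase a, ‖u i‖ :=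
        Finset.prod_congr rfl fun i hi => by
          rw [Function.update_of_ne (Finset.ne_of_mem_erase hi)]
      rw [this]
      ring
    have h2 : ψ (∑ j, (∏ i, (if i ∈ insert a s then T i (x j i) else x j i) (u i)) • z j) =
        T a (∑ j, c j • x j a) (u a) := by
      simp only [map_sum, map_smul, smul_eq_mul, sum_apply,
        smul_apply]
      refine Finset.sum_congr rfl fun j _ => ?_
      rw [← Finset.mul_prod_erase _ _ (Finset.mem_univ a), if_pos (Finset.mem_insert_self a s), hc]
      have : ∏ i ∈ Finset.univ.erase a, (if i ∈ insert a s then T i (x j i) else x j i) (u i) =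
          ∏ i ∈ Finset.univ.erase a, (if i ∈ s then T i (x j i) else x j i) (u i) :=
        Finset.prod_congr rfl fun i hi => by
          simp [Finset.mem_insert, Finset.ne_of_mem_erase hi]
      rw [this]
      ring
    have h3 : ‖T a (∑ j, c j • x j a) (u a)‖ ≤ ‖T a‖ * D * ‖u a‖ := by
      refine (ContinuousLinearMap.le_opNorm _ _).trans ?_
      gcongr
      refine (ContinuousLinearMap.le_opNorm _ _).trans ?_
      gcongr
    rw [← h2, hψ', RCLike.norm_ofReal, abs_norm] at h3
    refine h3.trans (le_of_eq ?_)
    rw [Finset.prod_insert ha, hD, ← Finset.mul_prod_erase _ _ (Finset.mem_univ a)]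
    ring

/-- For fixed φ, the ℓ_p-norms occurring in `weakSup` are those of the values of an n-linear
operator into finite-dimensional ℓ_p, with the vectors φ(y_j)e_j as coefficients. Hence
`norm_sum_smul_map_le` applies with values in ℓ_p. -/
theorem weakSup_map_le {ι : Type*} [Fintype ι] {p : ℝ} (hp : 1 ≤ p)
    (x : ι → ∀ i, StrongDual 𝕜 (E i)) (y : ι → F)
    (T : ∀ i, StrongDual 𝕜 (E i) →L[𝕜] StrongDual 𝕜 (E i)) {C : ℝ} (hC : 0 ≤ C)
    (h : weakSup p x y ≤ ENNReal.ofReal C) :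
    weakSup p (fun j i => T i (x j i)) y ≤ ENNReal.ofReal ((∏ i, ‖T i‖) * C) := by
  classical
  have : Fact (1 ≤ ENNReal.ofReal p) := ⟨by simpa using hp⟩
  refine weakSup_le_ofReal hp fun u hu φ hφ => ?_
  have e : ∀ c : ι → 𝕜, WithLp.toLp (ENNReal.ofReal p) (fun j => c j * φ (y j)) =
      ∑ j, c j • PiLp.single (ENNReal.ofReal p) j (φ (y j)) := fun c => by
    ext k
    simp [Pi.single_apply]
  have h1 := norm_sum_smul_map_le x
    (fun j => (PiLp.single (ENNReal.ofReal p) j (φ (y j)) : PiLp _ fun _ : ι => 𝕜)) hC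
    (fun v => by
      rw [← e]
      exact norm_toLp_le_of_weakSup_le hp hC h v hφ) T u
  rw [e]
  refine h1.trans (mul_le_of_le_one_right (by positivity) ?_)
  exact Finset.prod_le_one (fun _ _ => norm_nonneg _) fun i _ => hu i

end
-- Finite representations of small cost
section

variable {𝕜 : Type*} [RCLike 𝕜] {n : ℕ} {E : Fin n → Type*}
  [∀ i, NormedAddCommGroup (E i)] [∀ i, NormedSpace 𝕜 (E i)]
  {F : Type*} [NormedAddCommGroup F] [NormedSpace 𝕜 F] {p : ℝ}

/-- `B` has a finite representation whose coefficients have `ℓ_{p'}`-norm at most `a` and whose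
vectors have weak norm at most `b`. -/
def HasRepBound (𝕜 : Type*) [RCLike 𝕜] {n : ℕ} {E : Fin n → Type*}
    [∀ i, NormedAddCommGroup (E i)] [∀ i, NormedSpace 𝕜 (E i)]
    {F : Type*} [NormedAddCommGroup F] [NormedSpace 𝕜 F]
    (p : ℝ) (B : (∀ i, E i) → F) (a b : ℝ) : Prop :=
  ∃ (m : ℕ) (lam : Fin m → 𝕜) (x : Fin m → ∀ i, StrongDual 𝕜 (E i)) (y : Fin m → F),
    (∀ u, B u = ∑ j, (lam j * ∏ i, x j i (u i)) • y j) ∧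
      ‖WithLp.toLp (conjExp p) lam‖ ≤ a ∧ weakSup p x y ≤ ENNReal.ofReal b

theorem HasRepBound.of_fintype (hp : 1 ≤ p) {ι : Type*} [Fintype ι] {B : (∀ i, E i) → F} {a b : ℝ}
    (lam : ι → 𝕜) (x : ι → ∀ i, StrongDual 𝕜 (E i)) (y : ι → F)
    (hB : ∀ u, B u = ∑ j, (lam j * ∏ i, x j i (u i)) • y j)
    (ha : ‖WithLp.toLp (conjExp p) lam‖ ≤ a) (hb : weakSup p x y ≤ ENNReal.ofReal b) :
    HasRepBound 𝕜 p B a b := by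
  set e := (Fintype.equivFin ι).symm
  refine ⟨_, lam ∘ e, fun j => x (e j), fun j => y (e j), fun u => ?_, ?_, ?_⟩
  · rw [hB]
    exact (e.sum_comp fun j => (lam j * ∏ i, x j i (u i)) • y j).symm
  · rwa [norm_toLp_comp_equiv (one_le_conjExp p)]
  · exact (weakSup_comp_le hp x y e.injective).trans hb

theorem HasRepBound.add (hp : 1 ≤ p) {B B' : (∀ i, E i) → F} {a b a' b' : ℝ} (hb : 0 ≤ b)
    (hb' : 0 ≤ b') (h : HasRepBound 𝕜 p B a b) (h' : HasRepBound 𝕜 p B' a' b') :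
    HasRepBound 𝕜 p (fun u => B u + B' u) (a + a') (b + b') := by
  obtain ⟨m, lam, x, y, hB, h1, h2⟩ := h
  obtain ⟨m', lam', x', y', hB', h1', h2'⟩ := h'
  refine .of_fintype hp (Sum.elim lam lam') (Sum.elim x x') (Sum.elim y y') (fun u => ?_) ?_ ?_
  · simp [hB, hB']
  · exact (norm_toLp_sumElim_le (one_le_conjExp p) _ _).trans (add_le_add h1 h1')
  · rw [ENNReal.ofReal_add hb hb']
    exact (weakSup_sumElim_le hp _ _ _ _).trans (add_le_add h2 h2')

/-- Under `HasRepBound.add` both bounds add up, so a small product is not enough: each factor must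
be small. Moving a scalar between coefficients and vectors balances them. -/
theorem HasRepBound.rescale (hp : 1 ≤ p) {B : (∀ i, E i) → F} {a b t : ℝ} (ht : 0 < t)
    (h : HasRepBound 𝕜 p B a b) : HasRepBound 𝕜 p B (t * a) (t⁻¹ * b) := by
  have : Fact (1 ≤ conjExp p) := ⟨one_le_conjExp p⟩
  obtain ⟨m, lam, x, y, hB, h1, h2⟩ := h
  have ht' : (t : 𝕜) ≠ 0 := by simpa using ht.ne'
  refine ⟨m, (t : 𝕜) • lam, x, fun j => (t : 𝕜)⁻¹ • y j, fun u => ?_, ?_, ?_⟩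
  · rw [hB]
    refine Finset.sum_congr rfl fun j _ => ?_
    rw [smul_smul]
    congr 1
    simp only [Pi.smul_apply, smul_eq_mul]
    field_simp
  · rw [WithLp.toLp_smul, norm_smul, RCLike.norm_ofReal, abs_of_pos ht]
    gcongr
  · refine (weakSup_smul_le hp _ _ _).trans ?_
    rw [ENNReal.ofReal_mul (by positivity), ← ofReal_norm, norm_inv, RCLike.norm_ofReal,
      abs_of_pos ht]
    gcongr

/-- A finite sum of elementary operators, with a fixed number of summands, has a small
representation as soon as the sum of the norms of its terms is small. -/
theorem exists_pos_hasRepBound_sum (hp : 1 ≤ p) (κ : Type*) [Fintype κ] {ε : ℝ} (hε : 0 < ε) :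
    ∃ δ : ℝ, 0 < δ ∧ ∀ (f : κ → ∀ i, StrongDual 𝕜 (E i)) (y : κ → F),
      ∑ k, (∏ i, ‖f k i‖) * ‖y k‖ ≤ δ →
        HasRepBound 𝕜 p (fun u => ∑ k, (∏ i, f k i (u i)) • y k) ε ε := by
  have : Fact (1 ≤ conjExp p) := ⟨one_le_conjExp p⟩
  set c : ℝ := 1 + ‖WithLp.toLp (conjExp p) (fun _ : κ => (1 : 𝕜))‖ with hc
  have hc0 : 0 < c := by positivity
  refine ⟨ε / c * ε, by positivity, fun f y h => ?_⟩
  have h1 : HasRepBound 𝕜 p (fun u => ∑ k, (∏ i, f k i (u i)) • y k) c (ε / c * ε) :=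
    .of_fintype hp (fun _ => 1) f y (fun u => by simp) (by simp [hc])
      ((weakSup_le_sum hp f y).trans (ENNReal.ofReal_le_ofReal h))
  have h2 := h1.rescale hp (t := ε / c) (by positivity)
  rwa [div_mul_cancel₀ _ hc0.ne', inv_mul_cancel_left₀ (by positivity)] at h2

/-- Injectivity means that `G` separates the points of `N`, so in finite dimension `G` maps onto the
dual of `N`; the `v k` are preimages of the coordinate functionals of a basis. -/
theorem exists_separating_system {K G N : Type*} [Field K] [AddCommGroup G] [Module K G]
    [AddCommGroup N] [Module K N] [FiniteDimensional K N] (B : N →ₗ[K] G →ₗ[K] K)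
    (hB : Function.Injective B) :
    ∃ (d : ℕ) (b : Fin d → N) (v : Fin d → G), ∀ g, g = ∑ k, B g (v k) • b k := by
  have hB' : Function.Surjective B.flip := by
    rwa [← LinearMap.flip_injective_iff₂, LinearMap.flip_flip]
  set b := Module.finBasis K N
  choose v hv using fun k => hB' (b.coord k)
  refine ⟨_, b, v, fun g => ?_⟩
  conv_lhs => rw [← b.sum_repr g]
  refine Finset.sum_congr rfl fun k _ => ?_
  rw [← LinearMap.flip_apply, hv k]
  rfl

theorem exists_dual_system {𝕜 G : Type*} [RCLike 𝕜] [NormedAddCommGroup G] [NormedSpace 𝕜 G]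
    (N : Submodule 𝕜 (StrongDual 𝕜 G)) [hN : FiniteDimensional 𝕜 N] :
    ∃ (d : ℕ) (f : Fin d → StrongDual 𝕜 G) (v : Fin d → G),
      ∀ g ∈ N, ∀ u, g u = ∑ k, g (v k) * f k u := by
  have hB : Function.Injective ((ContinuousLinearMap.coeLM 𝕜).comp N.subtype :
      N →ₗ[𝕜] G →ₗ[𝕜] 𝕜) :=
    ContinuousLinearMap.coe_injective.comp Subtype.val_injective
  obtain ⟨d, b, v, h⟩ := @exists_separating_system 𝕜 G N _ _ _ N.addCommGroup N.module hN _ hB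
  refine ⟨d, fun k => b k, v, fun g hg u => ?_⟩
  have h' := congrArg (fun g : N => (g : StrongDual 𝕜 G) u) (h ⟨g, hg⟩)
  refine h'.trans ?_
  simp only [Submodule.coe_sum, Submodule.coe_smul, sum_apply, smul_apply, smul_eq_mul]
  rfl

/-- After finite-rank operators have acted on the functionals, operators of small norm have small
representations. -/
theorem exists_pos_hasRepBound_of_finiteRank (hp : 1 ≤ p)
    (T : ∀ i, StrongDual 𝕜 (E i) →L[𝕜] StrongDual 𝕜 (E i))
    (hT : ∀ i, FiniteDimensional 𝕜
      (LinearMap.range (T i : StrongDual 𝕜 (E i) →ₗ[𝕜] StrongDual 𝕜 (E i))))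
    {ε : ℝ} (hε : 0 < ε) :
    ∃ δ : ℝ, 0 < δ ∧ ∀ (ι : Type) [Fintype ι] (x : ι → ∀ i, StrongDual 𝕜 (E i)) (z : ι → F),
      (∀ u : ∀ i, E i, ‖∑ j, (∏ i, x j i (u i)) • z j‖ ≤ δ * ∏ i, ‖u i‖) →
        HasRepBound 𝕜 p (fun u => ∑ j, (∏ i, T i (x j i) (u i)) • z j) ε ε := by
  choose d f v hfv using fun i => have := hT i; exists_dual_system
    (LinearMap.range (T i : StrongDual 𝕜 (E i) →ₗ[𝕜] StrongDual 𝕜 (E i)))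
  obtain ⟨δ, hδ, H⟩ := exists_pos_hasRepBound_sum (𝕜 := 𝕜) (E := E) (F := F) hp
    (∀ i, Fin (d i)) hε
  set C : ℝ := ∑ k : ∀ i, Fin (d i),
    (∏ i, ‖f i (k i)‖) * ((∏ i, ‖T i‖) * ∏ i, ‖v i (k i)‖) with hC
  have hC0 : 0 ≤ C := by positivity
  -- Expanding each `T i (x j i)` in its dual system leaves a number of terms independent of `ι`,
  -- whose vectors are values of the transformed operator at the points `v i (k i)`. The 1 guards
  -- against C = 0.
  refine ⟨δ / (C + 1), by positivity, fun ι _ x z h => ?_⟩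
  have h1 := norm_sum_smul_map_le x z (by positivity) h T
  have e : (fun u : ∀ i, E i => ∑ j, (∏ i, T i (x j i) (u i)) • z j) =
      fun u => ∑ k : ∀ i, Fin (d i), (∏ i, f i (k i) (u i)) •
        ∑ j, (∏ i, T i (x j i) (v i (k i))) • z j := by
    ext u
    simp only [Finset.smul_sum]
    rw [Finset.sum_comm]
    refine Finset.sum_congr rfl fun j _ => ?_
    simp only [smul_smul, ← Finset.sum_smul]
    congr 1
    rw [Finset.prod_congr rfl fun i _ => hfv i (T i (x j i)) ⟨x j i, rfl⟩ (u i),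
      Finset.prod_univ_sum, Fintype.piFinset_univ]
    refine Finset.sum_congr rfl fun k _ => ?_
    rw [Finset.prod_mul_distrib, mul_comm]
  rw [e]
  refine H (fun k i => f i (k i)) _ ?_
  calc ∑ k : ∀ i, Fin (d i), (∏ i, ‖f i (k i)‖) * ‖∑ j, (∏ i, T i (x j i) (v i (k i))) • z j‖
      ≤ ∑ k : ∀ i, Fin (d i), (∏ i, ‖f i (k i)‖) *
          ((∏ i, ‖T i‖) * (δ / (C + 1)) * ∏ i, ‖v i (k i)‖) := by
        gcongr with k
        exact h1 _
    _ = C * (δ / (C + 1)) := by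
        rw [hC, Finset.sum_mul]
        exact Finset.sum_congr rfl fun k _ => by ring
    _ ≤ δ := by
        rw [mul_div_assoc', div_le_iff₀ (by positivity)]
        nlinarith

/-- Replacing the functionals of a finite representation by nearby ones changes the operator by one
with a small representation. -/
theorem exists_pos_hasRepBound_sub (hp : 1 ≤ p) {ι : Type*} [Fintype ι]
    (a : ι → ∀ i, StrongDual 𝕜 (E i)) (b : ι → F) {ε : ℝ} (hε : 0 < ε) :
    ∃ δ : ℝ, 0 < δ ∧ ∀ a' : ι → ∀ i, StrongDual 𝕜 (E i), (∀ j i, ‖a' j i - a j i‖ ≤ δ) →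
      HasRepBound 𝕜 p
        (fun u => ∑ j, (∏ i, a j i (u i)) • b j - ∑ j, (∏ i, a' j i (u i)) • b j) ε ε := by
  classical
  obtain ⟨η, hη, H⟩ := exists_pos_hasRepBound_sum (𝕜 := 𝕜) (E := E) (F := F) hp
    -- Expand ∏(a + (a' - a)) over the set t of slots that keep a. The term t = univ cancels, and
    -- every other term contains a difference, so `G` vanishes at 0.
    (ι × {t : Finset (Fin n) // t ≠ Finset.univ}) hε
  set G : ℝ → ℝ := fun d => ∑ k : ι × {t : Finset (Fin n) // t ≠ Finset.univ},
    (∏ i, if i ∈ k.2.1 then ‖a k.1 i‖ else d) * ‖b k.1‖ with hG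
  have hGc : Continuous G := by
    refine continuous_finsetSum _ fun k _ => (continuous_finsetProd _ fun i _ => ?_).mul_const _
    change Continuous fun d : ℝ => if i ∈ k.2.1 then ‖a k.1 i‖ else d
    split_ifs <;> fun_prop
  have hG0 : G 0 = 0 := by
    refine Finset.sum_eq_zero fun k _ => ?_
    obtain ⟨i, hi⟩ : ∃ i, i ∉ k.2.1 := by
      by_contra! h
      exact k.2.2 (Finset.eq_univ_iff_forall.2 h)
    rw [Finset.prod_eq_zero (Finset.mem_univ i) (if_neg hi), zero_mul]
  obtain ⟨δ, hδ, hGδ⟩ := Metric.continuous_iff.1 hGc 0 η hη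
  refine ⟨δ / 2, by positivity, fun a' ha' => ?_⟩
  have hsmall : G (δ / 2) ≤ η := by
    have := hGδ (δ / 2) (by rw [Real.dist_eq, sub_zero, abs_of_pos (by positivity)]; linarith)
    rw [hG0, Real.dist_eq, sub_zero] at this
    exact (le_abs_self _).trans this.le
  have e : (fun u : ∀ i, E i => ∑ j, (∏ i, a j i (u i)) • b j - ∑ j, (∏ i, a' j i (u i)) • b j) =
      fun u => ∑ k : ι × {t : Finset (Fin n) // t ≠ Finset.univ},
        (∏ i, (if i ∈ k.2.1 then a k.1 i else a' k.1 i - a k.1 i) (u i)) • -b k.1 := by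
    ext u
    rw [Fintype.sum_prod_type, ← Finset.sum_sub_distrib]
    refine Finset.sum_congr rfl fun j _ => ?_
    have h1 : ∏ i, a' j i (u i) = ∑ t : Finset (Fin n),
        ∏ i, (if i ∈ t then a j i else a' j i - a j i) (u i) := by
      have : ∀ i, a' j i (u i) = a j i (u i) + (a' j i - a j i) (u i) := fun i => by simp
      simp_rw [this, Fintype.prod_add]
      refine Finset.sum_congr rfl fun t _ => ?_
      rw [← Finset.prod_mul_prod_compl t
        fun i => (if i ∈ t then a j i else a' j i - a j i) (u i)]
      congr 1
      · exact Finset.prod_congr rfl fun i hi => by rw [if_pos hi]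
      · exact Finset.prod_congr rfl fun i hi => by rw [if_neg (Finset.mem_compl.1 hi)]
    rw [h1, Fintype.sum_eq_add_sum_subtype_ne _ Finset.univ]
    simp [add_smul, Finset.sum_smul]
  rw [e]
  refine H _ _ (le_trans ?_ hsmall)
  simp only [hG, norm_neg]
  gcongr with k _ i
  split_ifs
  · exact le_rfl
  · exact ha' _ _

end
-- From nuclear to finite representations
section

variable {𝕜 : Type*} [RCLike 𝕜] {n : ℕ} {E : Fin n → Type*}
  [∀ i, NormedAddCommGroup (E i)] [∀ i, NormedSpace 𝕜 (E i)]
  {F : Type*} [NormedAddCommGroup F] [NormedSpace 𝕜 F] {p : ℝ}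

theorem weakSup_zero {ι : Type*} (hp : 1 ≤ p) (x : ι → ∀ i, StrongDual 𝕜 (E i)) {y : ι → F}
    (hy : ∀ j, y j = 0) : weakSup p x y = 0 := by
  have hp0 : 0 < p := by linarith
  refine le_antisymm (iSup₂_le fun u φ => le_of_eq ?_) bot_le
  simp [hy, ENNReal.zero_rpow_of_pos hp0, hp0]

/-- Extending a finite representation by zero gives a `σ(p)`-nuclear representation. -/
theorem IsFiniteRep.exists_isNuclearRep (hp : 1 ≤ p) {A : ContinuousMultilinearMap 𝕜 E F} {m : ℕ}
    {lam : Fin m → 𝕜} {x : Fin m → ∀ i, StrongDual 𝕜 (E i)} {y : Fin m → F}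
    (h : IsFiniteRep A lam x y) :
    ∃ (lam' : lp (fun _ : ℕ => 𝕜) (conjExp p)) (x' : ℕ → ∀ i, StrongDual 𝕜 (E i)) (y' : ℕ → F),
      IsNuclearRep p A lam' x' y' ∧ ‖lam'‖ * (weakSup p x' y').toReal ≤
        ‖WithLp.toLp (conjExp p) lam‖ * (weakSup p x y).toReal := by
  have : Fact (1 ≤ conjExp p) := ⟨one_le_conjExp p⟩
  have hp0 : 0 < p := by linarith
  obtain ⟨lam', hlam', hnorm⟩ := exists_lp_extend (one_le_conjExp p) lam
  set x' : ℕ → ∀ i, StrongDual 𝕜 (E i) := fun j => if h : j < m then x ⟨j, h⟩ else 0 with hx'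
  set y' : ℕ → F := fun j => if h : j < m then y ⟨j, h⟩ else 0 with hy'
  have hy0 : ∀ j, m ≤ j → y' j = 0 := fun j hj => dif_neg (by omega)
  have hw : weakSup p x' y' ≤ weakSup p x y := by
    refine iSup₂_mono fun u φ => ENNReal.rpow_le_rpow (le_of_eq ?_) (by positivity)
    rw [tsum_eq_sum (s := Finset.range m), Finset.sum_range, tsum_fintype]
    · refine Finset.sum_congr rfl fun j _ => ?_
      simp [hx', hy']
    · intro j hj
      rw [hy0 j (by simpa using hj)]
      simp [hp0]
  have hfin : weakSup p x y < ∞ := weakSup_lt_top hp x y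
  refine ⟨lam', x', y', ⟨fun u => ?_, hw.trans_lt hfin, ?_⟩, ?_⟩
  · refine tendsto_const_nhds.congr' ?_
    filter_upwards [eventually_ge_atTop m] with N hN
    rw [h u, ← Finset.sum_subset (Finset.range_mono hN), Finset.sum_range]
    · refine Finset.sum_congr rfl fun j _ => ?_
      simp [hlam', hx', hy']
    · intro j _ hj
      rw [hy0 j (by simpa using hj), smul_zero]
  · refine tendsto_const_nhds.congr' ?_
    filter_upwards [eventually_ge_atTop m] with N hN
    exact (weakSup_zero hp _ fun j => hy0 _ (by omega)).symm
  · gcongr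
    exact hfin.ne

/-- Hölder bounds each finite block of the tail uniformly in its length, and the bound passes to the
pointwise limit. -/
theorem IsNuclearRep.norm_sub_sum_le (hp : 1 ≤ p) {A : ContinuousMultilinearMap 𝕜 E F}
    {lam : lp (fun _ : ℕ => 𝕜) (conjExp p)} {x : ℕ → ∀ i, StrongDual 𝕜 (E i)} {y : ℕ → F}
    (h : IsNuclearRep p A lam x y) {N : ℕ} {C : ℝ} (hC : 0 ≤ C)
    (hN : weakSup p (fun j => x (N + j)) (fun j => y (N + j)) ≤ ENNReal.ofReal C)
    (u : ∀ i, E i) :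
    ‖A u - ∑ j ∈ Finset.range N, (lam j * ∏ i, x j i (u i)) • y j‖ ≤ ‖lam‖ * C * ∏ i, ‖u i‖ := by
  have : Fact (1 ≤ conjExp p) := ⟨one_le_conjExp p⟩
  have ht := (((h.tendsto_sum u).comp (tendsto_add_atTop_nat N)).sub_const
    (∑ j ∈ Finset.range N, (lam j * ∏ i, x j i (u i)) • y j)).norm
  refine le_of_tendsto ht (Eventually.of_forall fun r => ?_)
  simp only [Function.comp_apply]
  rw [add_comm r N, Finset.sum_range_add, add_sub_cancel_left, Finset.sum_range]
  have hr : weakSup p (fun j : Fin r => x (N + j)) (fun j : Fin r => y (N + j)) ≤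
      ENNReal.ofReal C :=
    (weakSup_comp_le hp (fun j => x (N + j)) (fun j => y (N + j)) Fin.val_injective).trans hN
  refine (norm_sum_smul_le hp (fun j : Fin r => lam (N + j)) hC hr u).trans ?_
  gcongr
  exact norm_toLp_comp_le (one_le_conjExp p) lam (e := fun j : Fin r => N + (j : ℕ))
    fun i j hij => Fin.ext (by simpa using hij)

/-- Under the bounded approximation property, a `σ(p)`-nuclear representation of an operator of
finite type can be replaced by a finite one at arbitrarily small additional cost. -/
theorem IsNuclearRep.hasRepBound (hE : ∀ i, HasBAP 𝕜 (StrongDual 𝕜 (E i))) (hp : 1 ≤ p)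
    {A : ContinuousMultilinearMap 𝕜 E F} (hA : IsFiniteType A)
    {lam : lp (fun _ : ℕ => 𝕜) (conjExp p)} {x : ℕ → ∀ i, StrongDual 𝕜 (E i)} {y : ℕ → F}
    (h : IsNuclearRep p A lam x y) {ε : ℝ} (hε : 0 < ε) :
    HasRepBound 𝕜 p A (‖lam‖ + 3 * ε) ((weakSup p x y).toReal + 3 * ε) := by
  have : Fact (1 ≤ conjExp p) := ⟨one_le_conjExp p⟩
  obtain ⟨L, μ, a, b, hrep⟩ := hA
  choose γ hγ1 hγ using hE
  have hγ0 : ∀ i, 0 < γ i := fun i => by linarith [hγ1 i]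
  set Γ : ℝ := ∏ i, γ i with hΓ
  have hΓ0 : 0 < Γ := Finset.prod_pos fun i _ => hγ0 i
  -- Rescaling factor for the middle block: it brings the coefficient norm ‖λ‖ below ε, at the price
  -- of dividing the weak norm by t. Hence the tail bound tε/Γ below, with Γ absorbing ∏‖T_i‖.
  set t : ℝ := ε / (‖lam‖ + 1) with ht
  have ht0 : 0 < t := by positivity
  have htl : t * ‖lam‖ ≤ ε := by
    rw [ht, div_mul_eq_mul_div, div_le_iff₀ (by positivity)]
    nlinarith
  have htail : ∀ η : ℝ, 0 < η → ∀ᶠ N : ℕ in atTop,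
      weakSup p (fun j => x (N + j)) (fun j => y (N + j)) ≤ ENNReal.ofReal η := fun η hη =>
    ((tendsto_order.1 h.tendsto_tail).2 _ (ENNReal.ofReal_pos.2 hη)).mono fun _ => le_of_lt
  have hη0 : 0 < t * ε / Γ := by positivity
  obtain ⟨m, hm⟩ := (htail _ hη0).exists
  -- the `m`-th remainder of the series as an operator of finite type
  set a' : Fin L ⊕ Fin m → ∀ i, StrongDual 𝕜 (E i) := Sum.elim a (fun j => x j) with ha'
  set b' : Fin L ⊕ Fin m → F := Sum.elim (fun l => μ l • b l) (fun j => -(lam j • y j)) with hb'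
  obtain ⟨δ, hδ, hpert⟩ := exists_pos_hasRepBound_sub hp a' b' hε
  choose T hTfin hTγ hTδ using fun i =>
    hγ i (Set.range fun k => a' k i) (Set.finite_range _).isCompact δ hδ
  have hTΓ : ∏ i, ‖T i‖ ≤ Γ := Finset.prod_le_prod (fun _ _ => norm_nonneg _) fun i _ => hTγ i
  have hfour := hpert (fun k i => T i (a' k i)) fun k i => hTδ i _ ⟨k, rfl⟩
  obtain ⟨δ', hδ', hfr⟩ := exists_pos_hasRepBound_of_finiteRank (F := F) hp T hTfin hε
  have hη' : 0 < δ' / (‖lam‖ + 1) := by positivity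
  obtain ⟨N, hN, hmN⟩ := ((htail _ hη').and (eventually_ge_atTop m)).exists
  obtain ⟨k, rfl⟩ := Nat.exists_eq_add_of_le hmN
  -- R_{m+k} is written as the finite expression for R_m minus the block from m to m + k. With T
  -- applied, the two parts cancel formally against terms of `hfour` and `htwo`, so T need not be
  -- defined on operators.
  have hthree := hfr ((Fin L ⊕ Fin m) ⊕ Fin k) (Sum.elim a' fun j => x (m + j))
    (Sum.elim b' fun j => -(lam (m + j) • y (m + j))) (fun u => by
      have e : ∑ j, (∏ i, (Sum.elim a' (fun j : Fin k => x (m + j)) j) i (u i)) •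
          (Sum.elim b' (fun j : Fin k => -(lam (m + j) • y (m + j))) j) =
          A u - ∑ j ∈ Finset.range (m + k), (lam j * ∏ i, x j i (u i)) • y j := by
        rw [Finset.sum_range_add, Finset.sum_range, Finset.sum_range, hrep u]
        simp only [ha', hb', Fintype.sum_sum_type, Sum.elim_inl, Sum.elim_inr, smul_neg,
          Finset.sum_neg_distrib, smul_smul, mul_comm (∏ i, _)]
        abel
      rw [e]
      refine (h.norm_sub_sum_le hp hη'.le hN u).trans ?_
      gcongr
      rw [mul_div_assoc', div_le_iff₀ (by positivity)]
      nlinarith [norm_nonneg lam])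
  have hinj : Function.Injective fun j : Fin k => m + (j : ℕ) :=
    fun i j hij => Fin.ext (by simpa using hij)
  have htwo : HasRepBound 𝕜 p (fun u : ∀ i, E i => ∑ j : Fin k,
      (lam (m + j) * ∏ i, T i (x (m + j) i) (u i)) • y (m + j)) ‖lam‖ (Γ * (t * ε / Γ)) := by
    refine ⟨k, fun j => lam (m + j), fun j i => T i (x (m + j) i), fun j => y (m + j),
      fun u => rfl, norm_toLp_comp_le (one_le_conjExp p) lam hinj, ?_⟩
    refine (weakSup_map_le hp (fun j : Fin k => x (m + j)) _ T hη0.le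
      ((weakSup_comp_le hp (fun j => x (m + j)) (fun j => y (m + j))
        Fin.val_injective).trans hm)).trans (ENNReal.ofReal_le_ofReal ?_)
    gcongr
  have htwo' := htwo.rescale hp ht0
  rw [mul_div_cancel₀ _ hΓ0.ne', inv_mul_cancel_left₀ ht0.ne'] at htwo'
  have hone : HasRepBound 𝕜 p (fun u : ∀ i, E i => ∑ j : Fin m,
      (lam j * ∏ i, x j i (u i)) • y j) ‖lam‖ (weakSup p x y).toReal := by
    refine ⟨m, fun j => lam j, fun j => x j, fun j => y j, fun u => rfl,
      norm_toLp_comp_le (one_le_conjExp p) lam Fin.val_injective, ?_⟩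
    rw [ENNReal.ofReal_toReal h.weakSup_lt_top.ne]
    exact weakSup_comp_le hp x y Fin.val_injective
  obtain ⟨r, l, x₁, y₁, hsum, hl, hw⟩ := ((hone.add hp ENNReal.toReal_nonneg hε.le htwo').add hp
    (by positivity) hε.le hthree).add hp (by positivity) hε.le hfour
  refine ⟨r, l, x₁, y₁, fun u => ?_, hl.trans (by linarith),
    hw.trans (ENNReal.ofReal_le_ofReal (by linarith))⟩
  rw [← hsum u, hrep u]
  simp only [ha', hb', Fintype.sum_sum_type, Sum.elim_inl, Sum.elim_inr, smul_neg,
    Finset.sum_neg_distrib, smul_smul, mul_comm (∏ i, _)]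
  abel

theorem HasRepBound.finiteNuclearNorm_le {A : ContinuousMultilinearMap 𝕜 E F} {a b : ℝ}
    (hb : 0 ≤ b) (h : HasRepBound 𝕜 p A a b) : finiteNuclearNorm p A ≤ a * b := by
  have : Fact (1 ≤ conjExp p) := ⟨one_le_conjExp p⟩
  obtain ⟨m, lam, x, y, hrep, hl, hw⟩ := h
  refine csInf_le_of_le ⟨0, ?_⟩ ⟨m, lam, x, y, hrep, rfl⟩ ?_
  · rintro _ ⟨m, lam, x, y, -, rfl⟩
    positivity
  · exact mul_le_mul hl (ENNReal.toReal_le_of_le_ofReal hb hw) ENNReal.toReal_nonneg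
      ((norm_nonneg _).trans hl)

end
end SigmaNuclear

theorem proposition2p4 {𝕜 : Type*} [RCLike 𝕜] {n : ℕ} {E : Fin n → Type*}
    [∀ i, NormedAddCommGroup (E i)] [∀ i, NormedSpace 𝕜 (E i)] [∀ i, CompleteSpace (E i)]
    (hE : ∀ i, SigmaNuclear.HasBAP 𝕜 (StrongDual 𝕜 (E i)))
    {F : Type*} [NormedAddCommGroup F] [NormedSpace 𝕜 F] [CompleteSpace F]
    (p : ℝ) (hp : 1 ≤ p)
    (A : ContinuousMultilinearMap 𝕜 E F) (hA : SigmaNuclear.IsFiniteType A) :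
    SigmaNuclear.IsSigmaNuclear p A ∧
      SigmaNuclear.finiteNuclearNorm p A = SigmaNuclear.nuclearNorm p A := by
  have : Fact (1 ≤ SigmaNuclear.conjExp p) := ⟨SigmaNuclear.one_le_conjExp p⟩
  have hnuc : SigmaNuclear.IsSigmaNuclear p A := by
    obtain ⟨m, lam, x, y, h⟩ := hA
    obtain ⟨lam', x', y', h', -⟩ := h.exists_isNuclearRep hp
    exact ⟨lam', x', y', h'⟩
  refine ⟨hnuc, le_antisymm ?_ ?_⟩
  · obtain ⟨lam₀, x₀, y₀, h₀⟩ := hnuc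
    refine le_csInf ⟨_, lam₀, x₀, y₀, h₀, rfl⟩ ?_
    rintro _ ⟨lam, x, y, h, rfl⟩
    have hlim : Tendsto (fun ε : ℝ => (‖lam‖ + 3 * ε) *
        ((SigmaNuclear.weakSup p x y).toReal + 3 * ε)) (𝓝[>] 0)
        (𝓝 (‖lam‖ * (SigmaNuclear.weakSup p x y).toReal)) := by
      have hc : Continuous fun ε : ℝ => (‖lam‖ + 3 * ε) *
        ((SigmaNuclear.weakSup p x y).toReal + 3 * ε) := by fun_prop
      simpa using (hc.tendsto 0).mono_left nhdsWithin_le_nhds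
    -- The infimum is reached by letting ε decrease to 0 in the product of the two bounds.
    refine ge_of_tendsto hlim ?_
    filter_upwards [self_mem_nhdsWithin] with ε hε
    have hε : 0 < ε := hε
    exact (h.hasRepBound hE hp hA hε).finiteNuclearNorm_le (by positivity)
  · obtain ⟨m, lam, x, y, h⟩ := hA
    refine le_csInf ⟨_, m, lam, x, y, h, rfl⟩ ?_
    rintro _ ⟨m, lam, x, y, h, rfl⟩
    obtain ⟨lam', x', y', h', hle⟩ := h.exists_isNuclearRep hp
    refine csInf_le_of_le ⟨0, ?_⟩ ⟨lam', x', y', h', rfl⟩ hle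
    rintro _ ⟨lam, x, y, -, rfl⟩
    positivity
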